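/- A probabilistic weighted automaton over a finite alphabet $\Sigma$ consists of a finite set $Q$ of states, an initial probability distribution $\rho_I$ on $Q$, a probabilistic transition function $\delta$ assigning to each $(q,\sigma)\in Q\times\Sigma$ a probability distribution on $Q$, and a weight function $\gamma:Q\times\Sigma\times Q\to\mathbb{Q}$. For an infinite word $w=\sigma_1\sigma_2\dots\in\Sigma^\omega$, a run over $w$ is a sequence $r=q_0q_1\dots$ of states with $\rho_I(q_0)>0$ and $\delta(q_i,\sigma_{i+1})(q_{i+1})>0$ for all $i\ge 0$; its weight sequence is $\gamma(r)=v_0v_1\dots$ with $v_i=\gamma(q_i,\sigma_{i+1},q_{i+1})$. Let $\mathbb{P}^A$ be the unique probability measure on infinite state sequences that gives each finite prefix $q_0\dots q_k$ the probability $\rho_I(q_0)\prod_{i=1}^{k}\delta(q_{i-1},\sigma_i)(q_i)$. Put $\mathsf{LimAvg}(v)=\liminf_{n\to\infty}\frac1n\sum_{i=0}^{n-1}v_i$. Under the positive semantics $A$ generates the quantitative language $$L_A^{>0}(w)=\sup\{\eta\in\mathbb{R} \mid \mathbb{P}^A(\{r \text{ a run over } w \mid \mathsf{LimAvg}(\gamma(r))\ge\eta\})>0\},$$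 and under the almost-sure semantics it generates $$L_A^{=1}(w)=\sup\{\eta\in\mathbb{R} \mid \mathbb{P}^A(\{r \text{ a run over } w \mid \mathsf{LimAvg}(\gamma(r))\ge\eta\})=1\}.$$ A quantitative language $L:\Sigma^\omega\to\mathbb{R}$ is PosLimAvg-definable (resp. AsLimAvg-definable) if $L=L_A^{>0}$ (resp. $L=L_A^{=1}$) for some such $A$. A class of quantitative languages is closed under $\min$ (resp. $\max$) if, for every finite alphabet $\Sigma$ and all $L,L':\Sigma^\omega\to\mathbb{R}$ in the class, the pointwise $\min(L,L')$ (resp. $\max(L,L')$) is in the class. Let $\Sigma=\{a,b\}$ and, for $c\in\Sigma$ and $w=\sigma_1\sigma_2\dots$, let $L_c(w)=\liminf_{n\to\infty}\frac1n|\{1\le i\le n\mid \sigma_i=c\}|$. **Lemma.** 1. $L_a$ and $L_b$ are PosLimAvg-definable, but neither $\min(L_a,L_b)$ nor $1-\max(L_a,L_b)$ is PosLimAvg-definable. 2. $L_a$ and $L_b$ are AsLimAvg-definable, but $\max(L_a,L_b)$ is not AsLimAvg-definable. In particular, the class of PosLimAvg-definable languages is not closed under $\min$, and the class of AsLimAvg-definable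 languages is not closed under $\max$. -/

import Mathlib

open MeasureTheory ProbabilityTheory

/-- Infinite words over the alphabet `S`. -/
abbrev InfWord (S : Type*) : Type _ := ℕ → S

/-- Quantitative languages over the alphabet `S`. -/
abbrev QuantLanguage (S : Type*) : Type _ := InfWord S → ℝ

/-- The limit-average value `liminf_n (1/n) ∑_{i<n} v_i` of a sequence of rational numbers
(only ever applied to bounded sequences). -/
noncomputable def limAvg (v : ℕ → ℚ) : ℝ :=
  Filter.liminf (fun n : ℕ => (1 / (n : ℝ)) * ∑ i ∈ Finset.range n, (v i : ℝ)) Filter.atTop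

/-- A probabilistic weighted automaton with state set `Q` over the alphabet `S`. -/
structure ProbWeightedAutomaton (Q S : Type*) where
  /-- the initial distribution -/
  init : PMF Q
  /-- the probabilistic transition function -/
  trans : Q → S → PMF Q
  /-- the (rational) weight of every transition -/
  weight : Q → S → Q → ℚ

namespace ProbWeightedAutomaton

/-- The infinite runs of `A` over `w`; the letter read at step `i` is `w i`, so a run is
given by its sequence of states. -/
def runs {Q S : Type*} (A : ProbWeightedAutomaton Q S) (w : InfWord S) : Set (ℕ → Q) :=
  {r | 0 < A.init (r 0) ∧ ∀ i, 0 < A.trans (r i) (w i) (r (i + 1))}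

/-- The sequence of weights along a run. -/
def weights {Q S : Type*} (A : ProbWeightedAutomaton Q S) (w : InfWord S) (r : ℕ → Q) : ℕ → ℚ :=
  fun i => A.weight (r i) (w i) (r (i + 1))

/-- The transition kernel at step `n` on the word `w`: the next state is drawn from
`A.trans q (w n)`, where `q` is the last state of the history. -/
noncomputable def stepKernel {Q S : Type*} [Finite Q] [MeasurableSpace Q]
    [DiscreteMeasurableSpace Q] (A : ProbWeightedAutomaton Q S) (w : InfWord S) (n : ℕ) :
    Kernel (∀ _ : Finset.Iic n, Q) Q where
  toFun x := (A.trans (x ⟨n, Finset.mem_Iic.2 le_rfl⟩) (w n)).toMeasure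
  measurable' :=
    (Measurable.of_discrete (f := fun q : Q => (A.trans q (w n)).toMeasure)).comp
      (measurable_pi_apply _)

instance {Q S : Type*} [Finite Q] [MeasurableSpace Q] [DiscreteMeasurableSpace Q]
    (A : ProbWeightedAutomaton Q S) (w : InfWord S) (n : ℕ) :
    IsMarkovKernel (A.stepKernel w n) :=
  ⟨fun x => PMF.toMeasure.isProbabilityMeasure (A.trans (x ⟨n, Finset.mem_Iic.2 le_rfl⟩) (w n))⟩

/-- The probability measure on infinite sequences of states induced by `A` on the word `w`. -/
noncomputable def runMeasure {Q S : Type*} [Finite Q] [MeasurableSpace Q]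
    [DiscreteMeasurableSpace Q] (A : ProbWeightedAutomaton Q S) (w : InfWord S) :
    Measure (ℕ → Q) :=
  Kernel.trajMeasure (X := fun _ => Q) A.init.toMeasure (A.stepKernel w)

instance {Q S : Type*} [Finite Q] [MeasurableSpace Q] [DiscreteMeasurableSpace Q]
    (A : ProbWeightedAutomaton Q S) (w : InfWord S) : IsProbabilityMeasure (A.runMeasure w) :=
  haveI : IsProbabilityMeasure A.init.toMeasure := PMF.toMeasure.isProbabilityMeasure _
  inferInstanceAs (IsProbabilityMeasure
    (Kernel.trajMeasure (X := fun _ => Q) A.init.toMeasure (A.stepKernel w)))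

/-- `runMeasure` gives finite runs their usual probability, which determines it uniquely. -/
theorem runMeasure_cylinder {Q S : Type*} [Finite Q] [MeasurableSpace Q]
    [DiscreteMeasurableSpace Q] (A : ProbWeightedAutomaton Q S) (w : InfWord S)
    (q : ℕ → Q) (k : ℕ) :
    A.runMeasure w {r | ∀ i ≤ k, r i = q i} =
      A.init (q 0) * ∏ i ∈ Finset.range k, A.trans (q i) (w i) (q (i + 1)) := by
  have : IsProbabilityMeasure A.init.toMeasure := PMF.toMeasure.isProbabilityMeasure _
  induction k with
  | zero =>
    have h0 : {r : ℕ → Q | ∀ i ≤ 0, r i = q i} = (Preorder.frestrictLe (π := fun _ => Q) 0) ⁻¹'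
        {x | x ⟨0, Finset.mem_Iic.2 le_rfl⟩ = q 0} := by
      ext r
      simp [Preorder.frestrictLe]
    have hm : MeasurableSet {x : ∀ _ : Finset.Iic 0, Q |
        x ⟨0, Finset.mem_Iic.2 le_rfl⟩ = q 0} :=
      measurableSet_eq_fun (measurable_pi_apply _) measurable_const
    rw [h0, ← Measure.map_apply (by fun_prop) hm, runMeasure, Kernel.trajMeasure,
      Measure.map_comp _ _ (by fun_prop), Kernel.traj_map_frestrictLe, Kernel.partialTraj_self,
      Measure.id_comp, Measure.map_apply (by fun_prop) hm]
    have h1 : (MeasurableEquiv.piUnique (fun _ : Finset.Iic 0 => Q)).symm ⁻¹'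
        {x : ∀ _ : Finset.Iic 0, Q | x ⟨0, Finset.mem_Iic.2 le_rfl⟩ = q 0} = {q 0} := by
      ext y
      rfl
    simp only [Finset.range_zero, Finset.prod_empty, mul_one]
    rw [← PMF.toMeasure_apply_singleton A.init (q 0) (measurableSet_singleton _), ← h1]
  | succ k ih =>
    have hs : MeasurableSet {x : ∀ _ : Finset.Iic k, Q | ∀ i : Finset.Iic k, x i = q i} := by
      have : {x : ∀ _ : Finset.Iic k, Q | ∀ i : Finset.Iic k, x i = q i} = ⋂ i : Finset.Iic k, {x : ∀ _ : Finset.Iic k, Q | x i = q i} := by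
        ext x
        simp
      rw [this]
      exact MeasurableSet.iInter fun i =>
        measurableSet_eq_fun (measurable_pi_apply _) measurable_const
    have h1 : {r : ℕ → Q | ∀ i ≤ k + 1, r i = q i} =
        (fun x : ℕ → Q => (Preorder.frestrictLe (π := fun _ => Q) k x, x (k + 1))) ⁻¹'
          ({x : ∀ _ : Finset.Iic k, Q | ∀ i : Finset.Iic k, x i = q i} ×ˢ {q (k + 1)}) := by
      ext r
      simp only [Set.mem_ofPred_eq, Set.mem_preimage, Set.mem_prod, Set.mem_singleton_iff,
        Preorder.frestrictLe_apply, Subtype.forall, Finset.mem_Iic]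
      constructor
      · exact fun h => ⟨fun i hi => h i (by omega), h _ le_rfl⟩
      · rintro ⟨h, h'⟩ i hi
        rcases Nat.lt_or_ge k i with hk | hk
        · obtain rfl : i = k + 1 := by omega
          exact h'
        · exact h i hk
    have h2 : {r : ℕ → Q | ∀ i ≤ k, r i = q i} =
        (Preorder.frestrictLe (π := fun _ => Q) k) ⁻¹' {x : ∀ _ : Finset.Iic k, Q | ∀ i : Finset.Iic k, x i = q i} := by
      ext r
      simp [Preorder.frestrictLe_apply]
    rw [h2, ← Measure.map_apply (by fun_prop) hs] at ih
    rw [h1, ← Measure.map_apply (by fun_prop) (hs.prod (measurableSet_singleton _)), runMeasure,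
      ← Kernel.map_frestrictLe_trajMeasure_compProd_eq_map_trajMeasure (X := fun _ => Q)
        (κ := A.stepKernel w) (a := k),
      Measure.compProd_apply_prod hs (measurableSet_singleton _),
      setLIntegral_congr_fun (g := fun _ => A.trans (q k) (w k) (q (k + 1))) hs ?_,
      setLIntegral_const, Finset.prod_range_succ, ← mul_assoc, ← ih, mul_comm]
    · rfl
    · intro x hx
      have hk : x ⟨k, Finset.mem_Iic.2 le_rfl⟩ = q k := hx _
      change (A.trans (x ⟨k, Finset.mem_Iic.2 le_rfl⟩) (w k)).toMeasure {q (k + 1)} = _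
      rw [hk, PMF.toMeasure_apply_singleton _ _ (measurableSet_singleton _)]

/-- The value of `w` under the almost-sure semantics. -/
noncomputable def asValue {Q S : Type*} [Finite Q] [MeasurableSpace Q]
    [DiscreteMeasurableSpace Q] (Val : (ℕ → ℚ) → ℝ) (A : ProbWeightedAutomaton Q S) :
    QuantLanguage S :=
  fun w => sSup {η : ℝ | A.runMeasure w {r | r ∈ A.runs w ∧ η ≤ Val (A.weights w r)} = 1}

/-- The value of `w` under the positive semantics. -/
noncomputable def posValue {Q S : Type*} [Finite Q] [MeasurableSpace Q]
    [DiscreteMeasurableSpace Q] (Val : (ℕ → ℚ) → ℝ) (A : ProbWeightedAutomaton Q S) :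
    QuantLanguage S :=
  fun w => sSup {η : ℝ | 0 < A.runMeasure w {r | r ∈ A.runs w ∧ η ≤ Val (A.weights w r)}}

end ProbWeightedAutomaton

/-- The quantitative languages over `S` generated by a (finite-state) probabilistic
`LimAvg`-automaton under the positive semantics. -/
def PosLimAvg (S : Type) : Set (QuantLanguage S) :=
  {L | ∃ (Q : Type) (_ : Finite Q) (_ : MeasurableSpace Q) (_ : DiscreteMeasurableSpace Q)
    (A : ProbWeightedAutomaton Q S), A.posValue limAvg = L}

/-- The quantitative languages over `S` generated by a (finite-state) probabilistic
`LimAvg`-automaton under the almost-sure semantics. -/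
def AsLimAvg (S : Type) : Set (QuantLanguage S) :=
  {L | ∃ (Q : Type) (_ : Finite Q) (_ : MeasurableSpace Q) (_ : DiscreteMeasurableSpace Q)
    (A : ProbWeightedAutomaton Q S), A.asValue limAvg = L}

/-- A class of quantitative languages (over all finite alphabets) is closed under `min`. -/
def ClosedUnderMin (C : ∀ S : Type, Set (QuantLanguage S)) : Prop :=
  ∀ (S : Type) [Finite S] (L L' : QuantLanguage S), L ∈ C S → L' ∈ C S →
    (fun w => min (L w) (L' w)) ∈ C S

/-- A class of quantitative languages (over all finite alphabets) is closed under `max`. -/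
def ClosedUnderMax (C : ∀ S : Type, Set (QuantLanguage S)) : Prop :=
  ∀ (S : Type) [Finite S] (L L' : QuantLanguage S), L ∈ C S → L' ∈ C S →
    (fun w => max (L w) (L' w)) ∈ C S

/-- The two-letter alphabet `{a, b}`. -/
inductive Letter
  | a
  | b
  deriving DecidableEq

/-- The language assigning to `w` the long-run average number of occurrences of the
letter `c`. -/
noncomputable def letterFreq (c : Letter) : QuantLanguage Letter :=
  fun w => limAvg (fun i => if w i = c then 1 else 0)

/-! The non-definability results compare ultimately constant words with words whose letters change
at density zero. Reading one letter `s` forever turns the automaton into a finite Markov chain, and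
its Poisson equation (`exists_poisson_decomposition`) supplies a harmonic gain `g s` and a bias `h
s`. Along a slowly switching word, weight minus gain is a martingale difference minus an increment
of the bias. The first averages to zero by a strong law (`ae_tendsto_avg_of_orthogonal`). The second
telescopes, except for a bounded error at each letter change. So the limit average is almost surely
that of the gains met on the way (`IsGainBias.ae_tendsto_avg_sub`), hence lies between the extreme
gains of reachable states.

By the maximum principle, the reachable states of extreme gain for `s` are closed under `s`. An
ultimately constant word that leads to such a state therefore takes that gain as its limit average
with positive probability. Hence a positive value on a slowly switching word is at most the supremum
of the values on ultimately constant words, and an almost-sure value is at least their infimum.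

On ultimately constant words the two frequencies are 0 and 1, so the minimum is 0 and the maximum is
1. On `oddBlockWord`, which switches slowly, both frequencies are 1/2, a contradiction in each case.
-/

open Filter Topology

/-! ### Poisson equation -/

/-- Poisson equation for a linear contraction of a finite-dimensional space. -/
theorem exists_poisson_decomposition {V : Type*} [NormedAddCommGroup V] [NormedSpace ℝ V]
    [FiniteDimensional ℝ V] (T : V →ₗ[ℝ] V) (hT : ∀ x, ‖T x‖ ≤ ‖x‖) (v : V) :
    ∃ g h : V, T g = g ∧ v + T h - h = g := by
  set D : V →ₗ[ℝ] V := LinearMap.id - T with hD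
  have hpow : ∀ (n : ℕ) x, ‖(T ^ n) x‖ ≤ ‖x‖ := by
    intro n x
    induction n with
    | zero => simp
    | succ n ih =>
      rw [pow_succ', Module.End.mul_apply]
      exact (hT _).trans ih
  -- A fixed vector `D x` would give `T ^ n x = x - n • D x`, whose norm is unbounded unless `D x =
  -- 0`. Rank-nullity then makes kernel and range complementary.
  have hdisj : Disjoint (LinearMap.ker D) (LinearMap.range D) := by
    rw [Submodule.disjoint_def]
    rintro y hy ⟨x, rfl⟩
    have hfix : T (D x) = D x := by
      have : D x - T (D x) = 0 := hy
      exact (sub_eq_zero.1 this).symm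
    have hx : T x = x - D x := by simp [hD]
    have hn : ∀ n : ℕ, (T ^ n) x = x - (n : ℝ) • D x := by
      intro n
      induction n with
      | zero => simp
      | succ n ih =>
        rw [pow_succ', Module.End.mul_apply, ih, map_sub, map_smul, hfix, hx]
        push_cast
        module
    by_contra hne
    have hpos : 0 < ‖D x‖ := norm_pos_iff.2 hne
    obtain ⟨n, hn'⟩ := exists_nat_gt (2 * ‖x‖ / ‖D x‖)
    rw [div_lt_iff₀ hpos] at hn'
    have h1 : (n : ℝ) • D x = x - (T ^ n) x := by rw [hn n]; abel
    have h2 : (n : ℝ) * ‖D x‖ ≤ ‖x‖ + ‖x‖ := by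
      calc (n : ℝ) * ‖D x‖ = ‖(n : ℝ) • D x‖ := by rw [norm_smul]; simp
        _ = ‖x - (T ^ n) x‖ := by rw [h1]
        _ ≤ ‖x‖ + ‖(T ^ n) x‖ := norm_sub_le _ _
        _ ≤ _ := by gcongr; exact hpow n x
    linarith
  have htop : LinearMap.ker D ⊔ LinearMap.range D = ⊤ := by
    apply Submodule.eq_top_of_disjoint _ _ _ hdisj
    rw [add_comm, LinearMap.finrank_range_add_finrank_ker]
  have hv : v ∈ LinearMap.ker D ⊔ LinearMap.range D := by rw [htop]; trivial
  obtain ⟨g, hg, _, ⟨h, rfl⟩, hgh⟩ := Submodule.mem_sup.1 hv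
  refine ⟨g, h, ?_, ?_⟩
  · have : g - T g = 0 := hg
    exact (sub_eq_zero.1 this).symm
  · rw [← hgh]
    simp only [hD, LinearMap.sub_apply, LinearMap.id_apply]
    abel

/-! ### Cesàro averages and a strong law for orthogonal sequences -/

theorem tendsto_sqrt_div_atTop :
    Tendsto (fun n : ℕ => (n.sqrt : ℝ) / n) atTop (𝓝 0) := by
  have h : Tendsto (fun n : ℕ => ((n : ℝ) ^ (1 / 2 : ℝ))⁻¹) atTop (𝓝 0) :=
    ((tendsto_rpow_atTop (by norm_num)).comp tendsto_natCast_atTop_atTop).inv_tendsto_atTop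
  refine squeeze_zero (fun n => by positivity) (fun n => ?_) h
  rcases Nat.eq_zero_or_pos n with rfl | hn
  · simp
  have hn' : (0 : ℝ) < n := by exact_mod_cast hn
  rw [← Real.sqrt_eq_rpow, div_le_iff₀ hn', inv_mul_eq_div, Real.div_sqrt]
  exact Real.nat_sqrt_le_real_sqrt

theorem tendsto_sqrt_atTop : Tendsto Nat.sqrt atTop atTop :=
  tendsto_atTop_atTop.2 fun b => ⟨b * b, fun _ h => Nat.le_sqrt.2 h⟩

/-- Cesàro averages of a bounded sequence converge to zero as soon as they do along squares. -/
theorem tendsto_avg_of_tendsto_avg_sq (d : ℕ → ℝ) (C : ℝ) (hd : ∀ i, |d i| ≤ C)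
    (h : Tendsto (fun k : ℕ => (1 / ((k ^ 2 : ℕ) : ℝ)) * ∑ i ∈ Finset.range (k ^ 2), d i)
      atTop (𝓝 0)) :
    Tendsto (fun n : ℕ => (1 / (n : ℝ)) * ∑ i ∈ Finset.range n, d i) atTop (𝓝 0) := by
  have hC : 0 ≤ C := (abs_nonneg _).trans (hd 0)
  have h1 : Tendsto (fun n : ℕ =>
      |(1 / ((n.sqrt ^ 2 : ℕ) : ℝ)) * ∑ i ∈ Finset.range (n.sqrt ^ 2), d i|
        + 2 * C * ((n.sqrt : ℝ) / n)) atTop (𝓝 0) := by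
    simpa using ((h.comp tendsto_sqrt_atTop).abs).add (tendsto_sqrt_div_atTop.const_mul (2 * C))
  refine squeeze_zero_norm' ?_ h1
  filter_upwards [eventually_gt_atTop 0] with n hn
  set k := n.sqrt with hk
  have hk0 : 0 < k := Nat.sqrt_pos.2 hn
  have hkn : k ^ 2 ≤ n := Nat.sqrt_le' n
  have hnk : n ≤ k ^ 2 + 2 * k := by have := Nat.sqrt_le_add n; rw [← hk] at this; nlinarith
  have hn' : (0 : ℝ) < n := by exact_mod_cast hn
  have hk' : (0 : ℝ) < (k ^ 2 : ℕ) := by positivity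
  have hsplit : ∑ i ∈ Finset.range n, d i
      = ∑ i ∈ Finset.range (k ^ 2), d i + ∑ i ∈ Finset.Ico (k ^ 2) n, d i :=
    (Finset.sum_range_add_sum_Ico _ hkn).symm
  have htail : |∑ i ∈ Finset.Ico (k ^ 2) n, d i| ≤ 2 * k * C := by
    calc _ ≤ ∑ i ∈ Finset.Ico (k ^ 2) n, |d i| := Finset.abs_sum_le_sum_abs _ _
      _ ≤ ∑ i ∈ Finset.Ico (k ^ 2) n, C := Finset.sum_le_sum fun i _ => hd i
      _ = ((n - k ^ 2 : ℕ) : ℝ) * C := by simp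
      _ ≤ _ := by
        gcongr
        have : n - k ^ 2 ≤ 2 * k := by omega
        exact_mod_cast this
  rw [Real.norm_eq_abs, hsplit, mul_add]
  refine (abs_add_le _ _).trans (add_le_add ?_ ?_)
  · rw [abs_mul, abs_mul, abs_of_pos (by positivity : 0 < 1 / (n : ℝ)),
      abs_of_pos (by positivity : 0 < 1 / ((k ^ 2 : ℕ) : ℝ))]
    gcongr
  · rw [abs_mul, abs_of_pos (by positivity : 0 < 1 / (n : ℝ))]
    calc _ ≤ 1 / (n : ℝ) * (2 * k * C) := by gcongr
      _ = _ := by ring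

/-- Strong law of large numbers for uniformly bounded random variables each of which is
orthogonal to the sum of the previous ones. -/
theorem ae_tendsto_avg_of_orthogonal {Ω : Type*} [MeasurableSpace Ω] (μ : Measure Ω)
    [IsProbabilityMeasure μ] (D : ℕ → Ω → ℝ) (C : ℝ) (hm : ∀ i, Measurable (D i))
    (hD : ∀ i ω, |D i ω| ≤ C)
    (horth : ∀ n, ∫ ω, (∑ i ∈ Finset.range n, D i ω) * D n ω ∂μ = 0) :
    ∀ᵐ ω ∂μ, Tendsto (fun n : ℕ => (1 / (n : ℝ)) * ∑ i ∈ Finset.range n, D i ω)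
      atTop (𝓝 0) := by
  have hSm : ∀ n, Measurable fun ω => ∑ i ∈ Finset.range n, D i ω := fun n =>
    Finset.measurable_sum _ fun i _ => hm i
  have hSb : ∀ n ω, |∑ i ∈ Finset.range n, D i ω| ≤ n * C := by
    intro n ω
    calc _ ≤ ∑ i ∈ Finset.range n, |D i ω| := Finset.abs_sum_le_sum_abs _ _
      _ ≤ ∑ i ∈ Finset.range n, C := Finset.sum_le_sum fun i _ => hD i ω
      _ = _ := by simp
  have hint : ∀ (f : Ω → ℝ) (B : ℝ), Measurable f → (∀ ω, |f ω| ≤ B) → Integrable f μ :=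
    fun f B hf hB => Integrable.of_bound hf.aestronglyMeasurable B (ae_of_all _ hB)
  have hS2 : ∀ n, Integrable (fun ω => (∑ i ∈ Finset.range n, D i ω) ^ 2) μ := fun n =>
    hint _ ((n * C) ^ 2) ((hSm n).pow_const 2) fun ω => by
      rw [abs_pow]; exact pow_le_pow_left₀ (abs_nonneg _) (hSb n ω) 2
  -- Orthogonality kills the cross term, so second moments of the sums grow only linearly.
  have hvar : ∀ n : ℕ, ∫ ω, (∑ i ∈ Finset.range n, D i ω) ^ 2 ∂μ ≤ n * C ^ 2 := by
    intro n
    induction n with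
    | zero => simp
    | succ n ih =>
      have hc : Integrable (fun ω => (∑ i ∈ Finset.range n, D i ω) * D n ω) μ :=
        hint _ (n * C * C) ((hSm n).mul (hm n)) fun ω => by
          rw [abs_mul]
          exact mul_le_mul (hSb n ω) (hD n ω) (abs_nonneg _) ((abs_nonneg _).trans (hSb n ω))
      have hd : Integrable (fun ω => D n ω ^ 2) μ :=
        hint _ (C ^ 2) ((hm n).pow_const 2) fun ω => by
          rw [abs_pow]; exact pow_le_pow_left₀ (abs_nonneg _) (hD n ω) 2
      have hexp : ∀ ω, (∑ i ∈ Finset.range (n + 1), D i ω) ^ 2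
          = (∑ i ∈ Finset.range n, D i ω) ^ 2
            + (2 * ((∑ i ∈ Finset.range n, D i ω) * D n ω) + D n ω ^ 2) := by
        intro ω; rw [Finset.sum_range_succ]; ring
      simp_rw [hexp]
      have hcd : Integrable (fun ω => 2 * ((∑ i ∈ Finset.range n, D i ω) * D n ω) + D n ω ^ 2) μ :=
        (hc.const_mul 2).add hd
      rw [integral_add (hS2 n) hcd, integral_add (hc.const_mul 2) hd, integral_const_mul, horth n]
      have : ∫ ω, D n ω ^ 2 ∂μ ≤ ∫ _, C ^ 2 ∂μ :=
        integral_mono hd (integrable_const _) fun ω => by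
          simpa using pow_le_pow_left₀ (abs_nonneg _) (hD n ω) 2
      simp at this
      push_cast
      linarith
  -- Along squares the averages have second moment at most `C ^ 2 / k ^ 2`, which is summable. Hence
  -- `∑ Y k` is almost surely finite and its terms tend to zero.
  set Y : ℕ → Ω → ℝ := fun k ω =>
    ((1 / ((k ^ 2 : ℕ) : ℝ)) * ∑ i ∈ Finset.range (k ^ 2), D i ω) ^ 2 with hY
  have hYm : ∀ k, Measurable (Y k) := fun k => ((hSm _).const_mul _).pow_const 2
  have hYi : ∀ k, ∫⁻ ω, ENNReal.ofReal (Y k ω) ∂μ ≤ ENNReal.ofReal (C ^ 2 * (1 / (k : ℝ) ^ 2)) := by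
    intro k
    have hi : Integrable (Y k) μ := by
      simp only [hY, mul_pow]
      exact (hS2 _).const_mul _
    rw [← ofReal_integral_eq_lintegral_ofReal hi (ae_of_all _ fun ω => sq_nonneg _)]
    apply ENNReal.ofReal_le_ofReal
    simp only [hY, mul_pow]
    rw [integral_const_mul]
    rcases Nat.eq_zero_or_pos k with rfl | hk
    · simp
    calc _ ≤ (1 / ((k ^ 2 : ℕ) : ℝ)) ^ 2 * (((k ^ 2 : ℕ) : ℝ) * C ^ 2) := by
          gcongr; exact hvar _
      _ = _ := by push_cast; field_simp
  have hsum : ∫⁻ ω, ∑' k, ENNReal.ofReal (Y k ω) ∂μ ≠ ⊤ := by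
    rw [lintegral_tsum fun k => (hYm k).ennreal_ofReal.aemeasurable]
    refine ne_top_of_le_ne_top ?_ (ENNReal.tsum_le_tsum hYi)
    exact ((Real.summable_one_div_nat_pow.2 one_lt_two).mul_left (C ^ 2)).tsum_ofReal_ne_top
  filter_upwards [ae_lt_top (Measurable.tsum fun k => (hYm k).ennreal_ofReal) hsum]
    with ω hω
  refine tendsto_avg_of_tendsto_avg_sq _ C (fun i => hD i ω) ?_
  have h0 := ENNReal.tendsto_atTop_zero_of_tsum_ne_top hω.ne
  have h1 : Tendsto (fun k => Y k ω) atTop (𝓝 0) := by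
    have := (ENNReal.tendsto_toReal ENNReal.zero_ne_top).comp h0
    simpa [Function.comp_def, ENNReal.toReal_ofReal, hY, sq_nonneg] using this
  have h2 := (Real.continuous_sqrt.tendsto 0).comp h1
  simp only [Function.comp_def, hY, Real.sqrt_sq_eq_abs, Real.sqrt_zero] at h2
  exact (tendsto_zero_iff_abs_tendsto_zero _).2 h2

/-! ### One-step conditional means and the law of large numbers for runs -/

namespace ProbWeightedAutomaton

variable {Q S : Type*} [Fintype Q] [MeasurableSpace Q] [DiscreteMeasurableSpace Q]

/-- The expected value of `f` at the successor of `q` when reading `s`. -/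
noncomputable def stepMean {Q S : Type*} [Fintype Q] (A : ProbWeightedAutomaton Q S) (s : S)
    (q : Q) (f : Q → ℝ) : ℝ :=
  ∑ q', (A.trans q s q').toReal * f q'

theorem sum_trans_toReal {Q S : Type*} [Fintype Q] (A : ProbWeightedAutomaton Q S) (s : S)
    (q : Q) : ∑ q', (A.trans q s q').toReal = 1 := by
  rw [← ENNReal.toReal_sum fun q' _ => PMF.apply_ne_top _ _,
    ← tsum_fintype (L := .unconditional _), PMF.tsum_coe, ENNReal.toReal_one]

theorem abs_stepMean_le {Q S : Type*} [Fintype Q] (A : ProbWeightedAutomaton Q S) (s : S) (q : Q)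
    (f : Q → ℝ) (C : ℝ) (hf : ∀ q', |f q'| ≤ C) : |A.stepMean s q f| ≤ C := by
  calc |A.stepMean s q f| ≤ ∑ q', |(A.trans q s q').toReal * f q'| :=
        Finset.abs_sum_le_sum_abs _ _
    _ ≤ ∑ q', (A.trans q s q').toReal * C := by
        refine Finset.sum_le_sum fun q' _ => ?_
        rw [abs_mul, abs_of_nonneg ENNReal.toReal_nonneg]
        exact mul_le_mul_of_nonneg_left (hf q') ENNReal.toReal_nonneg
    _ = C := by rw [← Finset.sum_mul, sum_trans_toReal, one_mul]

/-- This is the Markov property: the joint law of the history up to `n` and the next state is the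
composition product of the history law with `stepKernel`, so the last variable can be integrated out
first. -/
theorem integral_history_mul_step (A : ProbWeightedAutomaton Q S) (w : InfWord S) (n : ℕ)
    (F : (ℕ → Q) → ℝ) (hF : ∀ r r' : ℕ → Q, (∀ i ≤ n, r i = r' i) → F r = F r')
    (φ : Q → Q → ℝ) :
    ∫ r, F r * φ (r n) (r (n + 1)) ∂A.runMeasure w =
      ∫ r, F r * A.stepMean (w n) (r n) (φ (r n)) ∂A.runMeasure w := by
  have : IsProbabilityMeasure A.init.toMeasure := PMF.toMeasure.isProbabilityMeasure _
  -- A finite history is extended by repeating its last state; `F` does not see the difference.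
  set G : (∀ _ : Finset.Iic n, Q) → ℝ := fun x =>
    F fun i => x ⟨min i n, Finset.mem_Iic.2 (min_le_right _ _)⟩ with hG
  set last : (∀ _ : Finset.Iic n, Q) → Q := fun x => x ⟨n, Finset.mem_Iic.2 le_rfl⟩ with hlast
  have hFG : ∀ r : ℕ → Q, F r = G (Preorder.frestrictLe (π := fun _ => Q) n r) := by
    intro r
    refine hF _ _ fun i hi => ?_
    simp [Preorder.frestrictLe_apply, min_eq_left hi]
  have hjoint := Kernel.map_frestrictLe_trajMeasure_compProd_eq_map_trajMeasure (X := fun _ => Q)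
        (μ₀ := A.init.toMeasure) (κ := A.stepKernel w) (a := n)
  have hmean : ∀ x : (∀ _ : Finset.Iic n, Q),
      ∫ y, G x * φ (last x) y ∂(A.stepKernel w n x) =
        G x * A.stepMean (w n) (last x) (φ (last x)) := by
    intro x
    rw [integral_const_mul]
    congr 1
    exact PMF.integral_eq_sum _ _
  set ψ : (∀ _ : Finset.Iic n, Q) × Q → ℝ := fun p => G p.1 * φ (last p.1) p.2 with hψ
  calc ∫ r, F r * φ (r n) (r (n + 1)) ∂A.runMeasure w
      = ∫ r, ψ (Preorder.frestrictLe (π := fun _ => Q) n r, r (n + 1)) ∂A.runMeasure w := by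
        refine integral_congr_ae (ae_of_all _ fun r => ?_)
        simp only [hψ, ← hFG]
        rfl
    _ = ∫ p, ψ p ∂((A.runMeasure w).map
          fun r : ℕ → Q => (Preorder.frestrictLe (π := fun _ => Q) n r, r (n + 1))) := by
        rw [integral_map (by fun_prop) (Measurable.of_discrete).aestronglyMeasurable]
    _ = ∫ p, ψ p ∂((A.runMeasure w).map (Preorder.frestrictLe (π := fun _ => Q) n) ⊗ₘ
          A.stepKernel w n) := by
        rw [runMeasure, hjoint]
    _ = ∫ x, ∫ y, ψ (x, y) ∂(A.stepKernel w n x)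
          ∂((A.runMeasure w).map (Preorder.frestrictLe (π := fun _ => Q) n)) := by
        have : IsProbabilityMeasure
            ((A.runMeasure w).map (Preorder.frestrictLe (π := fun _ => Q) n)) :=
          Measure.isProbabilityMeasure_map (by fun_prop)
        exact Measure.integral_compProd Integrable.of_finite
    _ = ∫ x, G x * A.stepMean (w n) (last x) (φ (last x))
          ∂((A.runMeasure w).map (Preorder.frestrictLe (π := fun _ => Q) n)) := by
        simp only [hψ, hmean]
    _ = ∫ r, G (Preorder.frestrictLe (π := fun _ => Q) n r) * A.stepMean (w n)
          (last (Preorder.frestrictLe (π := fun _ => Q) n r))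
          (φ (last (Preorder.frestrictLe (π := fun _ => Q) n r))) ∂A.runMeasure w := by
        rw [integral_map (by fun_prop) (Measurable.of_discrete).aestronglyMeasurable]
    _ = _ := by
        refine integral_congr_ae (ae_of_all _ fun r => ?_)
        simp only [← hFG]
        rfl

/-- Subtracting the conditional mean leaves increments orthogonal to every function of the history,
in particular to the sum of the earlier increments. -/
theorem ae_tendsto_avg_sub_stepMean (A : ProbWeightedAutomaton Q S) (w : InfWord S)
    (φ : ℕ → Q → Q → ℝ) (C : ℝ) (hφ : ∀ i q q', |φ i q q'| ≤ C) :
    ∀ᵐ r ∂A.runMeasure w, Tendsto (fun n : ℕ => (1 / (n : ℝ)) * ∑ i ∈ Finset.range n,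
      (φ i (r i) (r (i + 1)) - A.stepMean (w i) (r i) (φ i (r i)))) atTop (𝓝 0) := by
  have hmeas : ∀ (i : ℕ) (f : Q → Q → ℝ), Measurable fun r : ℕ → Q => f (r i) (r (i + 1)) :=
    fun i f =>
      have h : Measurable fun r : ℕ → Q => (r i, r (i + 1)) := by fun_prop
      (Measurable.of_discrete (f := fun p : Q × Q => f p.1 p.2)).comp h
  set ψ : ℕ → Q → Q → ℝ := fun i q q' => φ i q q' - A.stepMean (w i) q (φ i q) with hψ
  have hψb : ∀ i q q', |ψ i q q'| ≤ C + C := fun i q q' =>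
    (abs_sub _ _).trans (add_le_add (hφ _ _ _) (A.abs_stepMean_le _ _ _ _ (hφ i q)))
  have hmean : ∀ i q, A.stepMean (w i) q (ψ i q) = 0 := by
    intro i q
    simp only [hψ, stepMean, mul_sub, Finset.sum_sub_distrib]
    rw [← Finset.sum_mul, sum_trans_toReal, one_mul, sub_self]
  refine ae_tendsto_avg_of_orthogonal (A.runMeasure w) (fun i r => ψ i (r i) (r (i + 1))) (C + C)
    (fun i => hmeas i (ψ i)) (fun i r => hψb _ _ _) fun n => ?_
  rw [A.integral_history_mul_step w n (fun r => ∑ i ∈ Finset.range n, ψ i (r i) (r (i + 1)))]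
  · simp [hmean]
  · intro r r' h
    refine Finset.sum_congr rfl fun i hi => ?_
    have := Finset.mem_range.1 hi
    rw [h i (by omega), h (i + 1) (by omega)]

end ProbWeightedAutomaton

/-! ### Bounds on limit averages -/

theorem abs_avg_le (x : ℕ → ℝ) (B : ℝ) (hx : ∀ i, |x i| ≤ B) (n : ℕ) :
    |(1 / (n : ℝ)) * ∑ i ∈ Finset.range n, x i| ≤ B := by
  have hB : 0 ≤ B := (abs_nonneg _).trans (hx 0)
  rcases Nat.eq_zero_or_pos n with rfl | hn
  · simpa using hB
  have hn' : (0 : ℝ) < n := by exact_mod_cast hn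
  rw [abs_mul, abs_of_pos (by positivity : 0 < 1 / (n : ℝ)), one_div_mul_eq_div, div_le_iff₀ hn']
  calc _ ≤ ∑ i ∈ Finset.range n, |x i| := Finset.abs_sum_le_sum_abs _ _
    _ ≤ ∑ i ∈ Finset.range n, B := Finset.sum_le_sum fun i _ => hx i
    _ = _ := by simp [mul_comm]

theorem limAvg_le_of_eventually (v : ℕ → ℚ) (B c : ℝ) (hv : ∀ i, |(v i : ℝ)| ≤ B)
    (h : ∀ ε > 0, ∀ᶠ n : ℕ in atTop, (1 / (n : ℝ)) * ∑ i ∈ Finset.range n, (v i : ℝ) ≤ c + ε) :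
    limAvg v ≤ c := by
  refine le_of_forall_pos_le_add fun ε hε => ?_
  exact liminf_le_of_frequently_le (h ε hε).frequently
    (isBoundedUnder_of ⟨-B, fun n => (abs_le.1 (abs_avg_le _ B hv n)).1⟩)

theorem le_limAvg_of_eventually (v : ℕ → ℚ) (B c : ℝ) (hv : ∀ i, |(v i : ℝ)| ≤ B)
    (h : ∀ ε > 0, ∀ᶠ n : ℕ in atTop, c - ε ≤ (1 / (n : ℝ)) * ∑ i ∈ Finset.range n, (v i : ℝ)) :
    c ≤ limAvg v := by
  refine le_of_forall_pos_sub_le fun ε hε => ?_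
  exact le_liminf_of_le
    (isBoundedUnder_of ⟨B, fun n => (abs_le.1 (abs_avg_le _ B hv n)).2⟩).isCoboundedUnder_ge
    (h ε hε)

theorem abs_limAvg_le (v : ℕ → ℚ) (B : ℝ) (hv : ∀ i, |(v i : ℝ)| ≤ B) : |limAvg v| ≤ B := by
  refine abs_le.2 ⟨le_limAvg_of_eventually v B _ hv fun ε hε => ?_,
    limAvg_le_of_eventually v B _ hv fun ε hε => ?_⟩
  · exact Eventually.of_forall fun n => by linarith [(abs_le.1 (abs_avg_le _ B hv n)).1]
  · exact Eventually.of_forall fun n => by linarith [(abs_le.1 (abs_avg_le _ B hv n)).2]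

/-! ### Reachable states, support of the run measure, bounds on values -/

namespace ProbWeightedAutomaton

theorem exists_abs_weight_le {Q S : Type*} [Finite Q] [Finite S] (A : ProbWeightedAutomaton Q S) :
    ∃ B : ℝ, ∀ q s q', |(A.weight q s q' : ℝ)| ≤ B := by
  obtain ⟨B, hB⟩ := (Set.finite_range
    fun p : Q × S × Q => |(A.weight p.1 p.2.1 p.2.2 : ℝ)|).bddAbove
  exact ⟨B, fun q s q' => hB ⟨(q, s, q'), rfl⟩⟩

theorem exists_abs_limAvg_weights_le {Q S : Type*} [Finite Q] [Finite S]
    (A : ProbWeightedAutomaton Q S) : ∃ B : ℝ, ∀ w r, |limAvg (A.weights w r)| ≤ B := by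
  obtain ⟨B, hB⟩ := A.exists_abs_weight_le
  exact ⟨B, fun w r => abs_limAvg_le _ B fun i => hB _ _ _⟩

/-- The states that some finite run reaches. -/
def Reachable {Q S : Type*} (A : ProbWeightedAutomaton Q S) (q : Q) : Prop :=
  ∃ (w : InfWord S) (r : ℕ → Q) (n : ℕ), 0 < A.init (r 0) ∧
    (∀ i < n, 0 < A.trans (r i) (w i) (r (i + 1))) ∧ r n = q

theorem reachable_of_mem_runs {Q S : Type*} (A : ProbWeightedAutomaton Q S) (w : InfWord S)
    (r : ℕ → Q) (hr : r ∈ A.runs w) (i : ℕ) : A.Reachable (r i) :=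
  ⟨w, r, i, hr.1, fun j _ => hr.2 j, rfl⟩

theorem Reachable.step {Q S : Type*} {A : ProbWeightedAutomaton Q S} {q q' : Q} {s : S}
    (hq : A.Reachable q) (h : 0 < A.trans q s q') : A.Reachable q' := by
  obtain ⟨w, r, n, h0, hr, rfl⟩ := hq
  refine ⟨fun i => if i < n then w i else s, fun i => if i ≤ n then r i else q', n + 1, by simpa,
    fun i hi => ?_, by simp⟩
  rcases Nat.lt_succ_iff_lt_or_eq.1 hi with hi | rfl
  · simpa [hi, hi.le, Nat.succ_le_of_lt hi] using hr i hi
  · simpa using h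

variable {Q S : Type*} [MeasurableSpace Q] [DiscreteMeasurableSpace Q]

/-- The cylinder of a finite run to `q` has positive probability, which depends only on the first
`k` letters. The rest of the word stays free. -/
theorem Reachable.exists_measure_pos [Finite Q] {A : ProbWeightedAutomaton Q S} {q : Q}
    (hq : A.Reachable q) : ∃ (u : InfWord S) (k : ℕ), ∀ w : InfWord S, (∀ i < k, w i = u i) →
      0 < A.runMeasure w {r | r k = q} := by
  obtain ⟨u, r₀, k, h0, hr, rfl⟩ := hq
  refine ⟨u, k, fun w hw => ?_⟩
  refine lt_of_lt_of_le ?_ (measure_mono (s := {r | ∀ i ≤ k, r i = r₀ i}) ?_)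
  rotate_left
  · intro r h
    simp only [Set.mem_ofPred_eq] at h ⊢
    exact h k le_rfl
  rw [runMeasure_cylinder]
  refine ENNReal.mul_pos h0.ne' (Finset.prod_ne_zero_iff.2 fun i hi => ?_)
  rw [hw i (Finset.mem_range.1 hi)]
  exact (hr i (Finset.mem_range.1 hi)).ne'

theorem ae_mem_runs [Fintype Q] (A : ProbWeightedAutomaton Q S) (w : InfWord S) :
    ∀ᵐ r ∂A.runMeasure w, r ∈ A.runs w := by
  classical
  have h0 : ∀ᵐ r ∂A.runMeasure w, 0 < A.init (r 0) := by
    have hq : ∀ q : Q, ∀ᵐ r ∂A.runMeasure w, r 0 = q → 0 < A.init (r 0) := by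
      intro q
      rcases eq_or_ne (A.init q) 0 with h | h
      · have hc := A.runMeasure_cylinder w (fun _ => q) 0
        simp only [Finset.range_zero, Finset.prod_empty, mul_one, h, Nat.le_zero, forall_eq] at hc
        filter_upwards [measure_eq_zero_iff_ae_notMem.1 hc] with r hr hrq
        exact absurd hrq hr
      · exact ae_of_all _ fun r hr => by rw [hr]; exact pos_iff_ne_zero.2 h
    filter_upwards [ae_all_iff.2 hq] with r hr using hr _ rfl
  have h1 : ∀ i, ∀ᵐ r ∂A.runMeasure w, 0 < A.trans (r i) (w i) (r (i + 1)) := by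
    intro i
    -- The indicator of forbidden transitions has conditional mean zero, hence vanishes almost
    -- surely along the run.
    set φ : Q → Q → ℝ := fun q q' => if A.trans q (w i) q' = 0 then 1 else 0 with hφ
    have hmean : ∀ q, A.stepMean (w i) q (φ q) = 0 := fun q =>
      Finset.sum_eq_zero fun q' _ => by
        by_cases h : A.trans q (w i) q' = 0 <;> simp [hφ, h]
    have hint := A.integral_history_mul_step w i (fun _ => 1) (fun _ _ _ => rfl) φ
    simp only [one_mul, hmean, integral_zero] at hint
    have hmeas : Measurable fun r : ℕ → Q => φ (r i) (r (i + 1)) :=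
      have h : Measurable fun r : ℕ → Q => (r i, r (i + 1)) := by fun_prop
      (Measurable.of_discrete (f := fun p : Q × Q => φ p.1 p.2)).comp h
    have hφ0 : ∀ q q', 0 ≤ φ q q' := fun q q' => by simp only [hφ]; split_ifs <;> norm_num
    have hφ1 : ∀ q q', φ q q' ≤ 1 := fun q q' => by simp only [hφ]; split_ifs <;> norm_num
    rw [integral_eq_zero_iff_of_nonneg (fun r => hφ0 _ _)
      (Integrable.of_bound hmeas.aestronglyMeasurable 1 (ae_of_all _ fun r => by
        rw [Real.norm_eq_abs, abs_of_nonneg (hφ0 _ _)]; exact hφ1 _ _))] at hint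
    filter_upwards [hint] with r hr
    refine pos_iff_ne_zero.2 fun h => ?_
    simp [hφ, h] at hr
  filter_upwards [h0, ae_all_iff.2 h1] with r hr0 hr1 using ⟨hr0, hr1⟩

section Values

variable [Fintype Q] (A : ProbWeightedAutomaton Q S) (w : InfWord S)

theorem measure_runs_limAvg_eq_one (c : ℝ)
    (h : ∀ᵐ r ∂A.runMeasure w, c ≤ limAvg (A.weights w r)) :
    A.runMeasure w {r | r ∈ A.runs w ∧ c ≤ limAvg (A.weights w r)} = 1 := by
  rw [← measure_univ (μ := A.runMeasure w)]
  refine measure_congr (eventuallyEq_univ.2 ?_)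
  filter_upwards [A.ae_mem_runs w, h] with r h1 h2 using ⟨h1, h2⟩

variable [Finite S]

/-- Finiteness of the alphabet bounds the weights by some `B`. The threshold `-B` keeps the set
under `sSup` nonempty, so the default value for the empty set never occurs. -/
theorem posValue_le (c : ℝ) (h : ∀ᵐ r ∂A.runMeasure w, limAvg (A.weights w r) ≤ c) :
    A.posValue limAvg w ≤ c := by
  obtain ⟨B, hB⟩ := A.exists_abs_limAvg_weights_le
  refine csSup_le ⟨-B, ?_⟩ fun η hη => ?_
  · rw [Set.mem_ofPred_eq, A.measure_runs_limAvg_eq_one w (-B)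
      (ae_of_all _ fun r => (abs_le.1 (hB w r)).1)]
    exact one_pos
  · by_contra! hc
    refine (ne_of_gt hη) (measure_eq_zero_iff_ae_notMem.2 ?_)
    filter_upwards [h] with r hr hr'
    exact absurd (hr'.2.trans hr) (not_le.2 hc)

theorem le_posValue (c : ℝ)
    (h : 0 < A.runMeasure w {r | r ∈ A.runs w ∧ c ≤ limAvg (A.weights w r)}) :
    c ≤ A.posValue limAvg w := by
  obtain ⟨B, hB⟩ := A.exists_abs_limAvg_weights_le
  refine le_csSup ⟨B, fun η hη => ?_⟩ h
  obtain ⟨r, hr⟩ := nonempty_of_measure_ne_zero (ne_of_gt hη)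
  exact hr.2.trans (abs_le.1 (hB w r)).2

theorem le_asValue (c : ℝ) (h : ∀ᵐ r ∂A.runMeasure w, c ≤ limAvg (A.weights w r)) :
    c ≤ A.asValue limAvg w := by
  obtain ⟨B, hB⟩ := A.exists_abs_limAvg_weights_le
  refine le_csSup ⟨B, fun η hη => ?_⟩ (A.measure_runs_limAvg_eq_one w c h)
  obtain ⟨r, hr⟩ := nonempty_of_measure_ne_zero
    (ne_of_gt (lt_of_lt_of_eq one_pos (Eq.symm hη)))
  exact hr.2.trans (abs_le.1 (hB w r)).2

/-- An event of positive probability suffices: any threshold above `c` confines the good runs to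
`Eᶜ` up to a null set, and `Eᶜ` has probability less than 1. -/
theorem asValue_le (c : ℝ) (E : Set (ℕ → Q)) (hE : MeasurableSet E) (hpos : 0 < A.runMeasure w E)
    (h : ∀ᵐ r ∂A.runMeasure w, r ∈ E → limAvg (A.weights w r) ≤ c) :
    A.asValue limAvg w ≤ c := by
  obtain ⟨B, hB⟩ := A.exists_abs_limAvg_weights_le
  refine csSup_le ⟨-B, A.measure_runs_limAvg_eq_one w (-B)
      (ae_of_all _ fun r => (abs_le.1 (hB w r)).1)⟩ fun η hη => ?_
  by_contra! hc
  have hle : A.runMeasure w {r | r ∈ A.runs w ∧ η ≤ limAvg (A.weights w r)}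
      ≤ A.runMeasure w Eᶜ := by
    refine measure_mono_ae ?_
    filter_upwards [h] with r hr hr' hrE
    exact absurd (hr'.2.trans (hr hrE)) (not_le.2 hc)
  rw [Set.mem_ofPred_eq] at hη
  rw [hη, prob_compl_eq_one_sub hE] at hle
  exact absurd hle (not_le.2 (ENNReal.sub_lt_self ENNReal.one_ne_top one_ne_zero hpos.ne'))

end Values

end ProbWeightedAutomaton

/-! ### Slowly switching words -/

/-- The positions at which the letter of `w` changes have density zero. -/
def SlowlySwitching {S : Type*} (w : InfWord S) : Prop :=
  ∃ σ : ℕ → ℕ, Monotone σ ∧ (∀ i, w (i + 1) ≠ w i → σ i < σ (i + 1)) ∧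
    Tendsto (fun n : ℕ => (σ n : ℝ) / n) atTop (𝓝 0)

theorem slowlySwitching_of_eventually_const {S : Type*} (w : InfWord S) (k : ℕ) (s : S)
    (hw : ∀ i, k ≤ i → w i = s) : SlowlySwitching w := by
  refine ⟨fun i => min i k, fun i j h => min_le_min_right k h, fun i hi => ?_, ?_⟩
  · by_contra! h
    have : k ≤ i := by grind
    exact hi (by rw [hw i this, hw (i + 1) (by omega)])
  · refine squeeze_zero (fun n => by positivity) (fun n => ?_)
      (tendsto_const_div_atTop_nhds_zero_nat (k : ℝ))
    gcongr
    exact_mod_cast min_le_right _ _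

/-- Along a slowly switching word, letter-dependent potentials telescope up to sublinear terms. -/
theorem SlowlySwitching.tendsto_avg_telescope {Q S : Type*} {w : InfWord S}
    (hw : SlowlySwitching w) (h : S → Q → ℝ) (H : ℝ) (hH : ∀ s q, |h s q| ≤ H) (r : ℕ → Q) :
    Tendsto (fun n : ℕ => (1 / (n : ℝ)) * ∑ i ∈ Finset.range n,
      (h (w i) (r (i + 1)) - h (w i) (r i))) atTop (𝓝 0) := by
  obtain ⟨σ, hmono, hσ, hlim⟩ := hw
  -- The sum is compared with its full telescoping. Each letter change costs at most `2 * H` and is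
  -- paid for by an increase of `σ`.
  have hbound : ∀ n : ℕ, |∑ i ∈ Finset.range n, (h (w i) (r (i + 1)) - h (w i) (r i))
      - (h (w n) (r n) - h (w 0) (r 0))| ≤ 2 * H * ((σ n : ℝ) - σ 0) := by
    intro n
    induction n with
    | zero => simp
    | succ n ih =>
      have hstep : |h (w n) (r (n + 1)) - h (w (n + 1)) (r (n + 1))|
          ≤ 2 * H * ((σ (n + 1) : ℝ) - σ n) := by
        have hH0 : 0 ≤ H := (abs_nonneg _).trans (hH (w n) (r n))
        by_cases heq : w (n + 1) = w n
        · rw [heq, sub_self, abs_zero]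
          have : (σ n : ℝ) ≤ σ (n + 1) := by exact_mod_cast hmono (Nat.le_succ n)
          have : 0 ≤ (σ (n + 1) : ℝ) - σ n := by linarith
          positivity
        · have h1 : (σ n : ℝ) + 1 ≤ σ (n + 1) := by exact_mod_cast hσ n heq
          calc _ ≤ |h (w n) (r (n + 1))| + |h (w (n + 1)) (r (n + 1))| := abs_sub _ _
            _ ≤ H + H := add_le_add (hH _ _) (hH _ _)
            _ ≤ _ := by nlinarith
      rw [Finset.sum_range_succ]
      rw [abs_le] at ih hstep ⊢
      constructor <;> linarith [ih.1, ih.2, hstep.1, hstep.2]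
  have hlim' : Tendsto (fun n : ℕ => 2 * H * ((σ n : ℝ) / n) + (2 * H) / n) atTop (𝓝 0) := by
    simpa using (hlim.const_mul (2 * H)).add (tendsto_const_div_atTop_nhds_zero_nat (2 * H))
  refine squeeze_zero_norm (fun n => ?_) hlim'
  have hH0 : 0 ≤ H := (abs_nonneg _).trans (hH (w 0) (r 0))
  rw [Real.norm_eq_abs, abs_mul, abs_of_nonneg (by positivity : 0 ≤ 1 / (n : ℝ))]
  have h2 : |∑ i ∈ Finset.range n, (h (w i) (r (i + 1)) - h (w i) (r i))|
      ≤ 2 * H * σ n + 2 * H := by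
    have h1 := abs_le.1 (hbound n)
    have h3 := abs_le.1 (hH (w n) (r n))
    have h4 := abs_le.1 (hH (w 0) (r 0))
    have h5 : 0 ≤ 2 * H * (σ 0 : ℝ) := by positivity
    rw [abs_le]
    constructor <;> nlinarith [h1.1, h1.2, h3.1, h3.2, h4.1, h4.2]
  calc _ ≤ 1 / (n : ℝ) * (2 * H * σ n + 2 * H) := by gcongr
    _ = _ := by ring

/-! ### Gain, bias and the maximum principle -/

namespace ProbWeightedAutomaton

section GainBias

variable {Q S : Type*} [Fintype Q]

/-- The pair of a gain `g` and a bias `h` solving, for every letter, the Poisson equation of the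
Markov chain of `A` on that letter. -/
structure IsGainBias (A : ProbWeightedAutomaton Q S) (g h : S → Q → ℝ) : Prop where
  harmonic : ∀ s q, A.stepMean s q (g s) = g s q
  poisson : ∀ s q, A.stepMean s q (fun q' => (A.weight q s q' : ℝ) + h s q') = g s q + h s q

theorem stepMean_add (A : ProbWeightedAutomaton Q S) (s : S) (q : Q) (f f' : Q → ℝ) :
    A.stepMean s q (fun q' => f q' + f' q') = A.stepMean s q f + A.stepMean s q f' := by
  simp [stepMean, mul_add, Finset.sum_add_distrib]

/-- For each letter, averaging over successors is a contraction in the sup norm on `Q → ℝ`, so the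
Poisson decomposition applies to the mean one-step weight. -/
theorem exists_isGainBias (A : ProbWeightedAutomaton Q S) : ∃ g h, A.IsGainBias g h := by
  have key : ∀ s, ∃ g h : Q → ℝ, (∀ q, A.stepMean s q g = g q) ∧
      ∀ q, A.stepMean s q (fun q' => (A.weight q s q' : ℝ) + h q') = g q + h q := by
    intro s
    let T : (Q → ℝ) →ₗ[ℝ] (Q → ℝ) :=
      { toFun := fun f q => A.stepMean s q f
        map_add' := fun f f' => funext fun q => A.stepMean_add s q f f'
        map_smul' := fun c f => funext fun q => by
          simp [stepMean, Finset.mul_sum, mul_left_comm] }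
    obtain ⟨g, h, hg, hgh⟩ := exists_poisson_decomposition T
      (fun f => (pi_norm_le_iff_of_nonneg (norm_nonneg f)).2 fun q =>
        A.abs_stepMean_le s q f _ fun q' => norm_le_pi_norm f q')
      (fun q => A.stepMean s q fun q' => (A.weight q s q' : ℝ))
    refine ⟨g, h, fun q => congrFun hg q, fun q => ?_⟩
    have : A.stepMean s q (fun q' => (A.weight q s q' : ℝ)) + A.stepMean s q h - h q = g q :=
      congrFun hgh q
    rw [stepMean_add]
    linarith
  choose g h hg hh using key
  exact ⟨g, h, hg, hh⟩

/-- A function that is harmonic at `q` and attains there its maximum over the successors of `q`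
is constant on these successors. -/
theorem eq_of_stepMean_eq_of_le (A : ProbWeightedAutomaton Q S) (s : S) (q : Q) (f : Q → ℝ)
    (hf : A.stepMean s q f = f q) (hle : ∀ q', 0 < A.trans q s q' → f q' ≤ f q) (q' : Q)
    (hq' : 0 < A.trans q s q') : f q' = f q := by
  have h0 : ∑ p, (A.trans q s p).toReal * (f q - f p) = 0 := by
    simp only [mul_sub, Finset.sum_sub_distrib]
    rw [← Finset.sum_mul, sum_trans_toReal, one_mul]
    exact sub_eq_zero.2 hf.symm
  have hnn : ∀ p ∈ Finset.univ, 0 ≤ (A.trans q s p).toReal * (f q - f p) := fun p _ => by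
    rcases eq_or_ne (A.trans q s p) 0 with hp | hp
    · simp [hp]
    · exact mul_nonneg ENNReal.toReal_nonneg (sub_nonneg.2 (hle p (pos_iff_ne_zero.2 hp)))
  have h1 := (Finset.sum_eq_zero_iff_of_nonneg hnn).1 h0 q' (Finset.mem_univ _)
  rcases mul_eq_zero.1 h1 with h2 | h2
  · exact absurd h2 (ENNReal.toReal_pos hq'.ne' (PMF.apply_ne_top _ _)).ne'
  · linarith

/-- Successors of reachable states are reachable, so at a maximizer over the reachable states the
maximum principle keeps every successor in the same level set. -/
theorem exists_closed_max (A : ProbWeightedAutomaton Q S) (s : S) (f : Q → ℝ)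
    (hf : ∀ q, A.stepMean s q f = f q) (q₀ : Q) (hq₀ : A.Reachable q₀) :
    ∃ q, A.Reachable q ∧ f q₀ ≤ f q ∧
      ∀ p, A.Reachable p → f p = f q → ∀ p', 0 < A.trans p s p' → f p' = f q := by
  obtain ⟨q, hq, hmax⟩ := Set.exists_max_image {q | A.Reachable q} f (Set.toFinite _) ⟨q₀, hq₀⟩
  refine ⟨q, hq, hmax _ hq₀, fun p hp hpq p' hp' => ?_⟩
  rw [← hpq]
  refine A.eq_of_stepMean_eq_of_le s p f (hf p) (fun p'' h'' => ?_) p' hp'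
  rw [hpq]
  exact hmax _ (hp.step h'')

theorem exists_closed_min (A : ProbWeightedAutomaton Q S) (s : S) (f : Q → ℝ)
    (hf : ∀ q, A.stepMean s q f = f q) (q₀ : Q) (hq₀ : A.Reachable q₀) :
    ∃ q, A.Reachable q ∧ f q ≤ f q₀ ∧
      ∀ p, A.Reachable p → f p = f q → ∀ p', 0 < A.trans p s p' → f p' = f q := by
  obtain ⟨q, hq, hle, hcl⟩ := A.exists_closed_max s (fun q => -f q) (fun q => by
    have := hf q
    simp only [stepMean, mul_neg, Finset.sum_neg_distrib] at this ⊢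
    rw [this]) q₀ hq₀
  simp only [neg_inj] at hcl
  exact ⟨q, hq, neg_le_neg_iff.1 hle, hcl⟩

end GainBias

/-! ### Values on slowly switching versus ultimately constant words -/

variable {Q S : Type*} [MeasurableSpace Q] [DiscreteMeasurableSpace Q] [Fintype Q] [Finite S]
  {A : ProbWeightedAutomaton Q S} {g h : S → Q → ℝ}

/-- By the Poisson equation, weight plus bias of the successor has conditional mean gain plus
current bias. The strong law handles the deviation from this mean, and slow switching removes the
bias increments. -/
theorem IsGainBias.ae_tendsto_avg_sub (hgh : A.IsGainBias g h) {w : InfWord S}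
    (hw : SlowlySwitching w) :
    ∀ᵐ r ∂A.runMeasure w, Tendsto (fun n : ℕ =>
      (1 / (n : ℝ)) * ∑ i ∈ Finset.range n, (A.weights w r i : ℝ)
        - (1 / (n : ℝ)) * ∑ i ∈ Finset.range n, g (w i) (r i)) atTop (𝓝 0) := by
  obtain ⟨B, hB⟩ := A.exists_abs_weight_le
  obtain ⟨H, hH⟩ := (Set.finite_range fun p : S × Q => |h p.1 p.2|).bddAbove
  have hH' : ∀ s q, |h s q| ≤ H := fun s q => hH ⟨(s, q), rfl⟩
  filter_upwards [A.ae_tendsto_avg_sub_stepMean w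
    (fun i q q' => (A.weight q (w i) q' : ℝ) + h (w i) q') (B + H)
    fun i q q' => (abs_add_le _ _).trans (add_le_add (hB _ _ _) (hH' _ _))] with r hr
  have h1 := hr.sub (hw.tendsto_avg_telescope h H hH' r)
  simp only [hgh.poisson, sub_zero] at h1
  refine h1.congr fun n => ?_
  rw [← mul_sub, ← mul_sub, ← Finset.sum_sub_distrib, ← Finset.sum_sub_distrib]
  congr 1
  refine Finset.sum_congr rfl fun i _ => ?_
  simp only [weights]
  ring

theorem IsGainBias.ae_limAvg_le (hgh : A.IsGainBias g h) {w : InfWord S}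
    (hw : SlowlySwitching w) (c : ℝ) (hg : ∀ s q, A.Reachable q → g s q ≤ c) :
    ∀ᵐ r ∂A.runMeasure w, limAvg (A.weights w r) ≤ c := by
  obtain ⟨B, hB⟩ := A.exists_abs_weight_le
  filter_upwards [hgh.ae_tendsto_avg_sub hw, A.ae_mem_runs w] with r hr hrun
  refine limAvg_le_of_eventually _ B c (fun i => hB _ _ _) fun ε hε => ?_
  filter_upwards [hr.eventually (gt_mem_nhds hε), eventually_gt_atTop 0] with n hn hn0
  have hn' : (0 : ℝ) < n := by exact_mod_cast hn0
  have : (1 / (n : ℝ)) * ∑ i ∈ Finset.range n, g (w i) (r i) ≤ c := by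
    rw [one_div_mul_eq_div, div_le_iff₀ hn']
    calc _ ≤ ∑ i ∈ Finset.range n, c :=
          Finset.sum_le_sum fun i _ => hg _ _ (A.reachable_of_mem_runs w r hrun i)
      _ = _ := by simp [mul_comm]
  linarith

theorem IsGainBias.ae_le_limAvg (hgh : A.IsGainBias g h) {w : InfWord S}
    (hw : SlowlySwitching w) (c : ℝ) (hg : ∀ s q, A.Reachable q → c ≤ g s q) :
    ∀ᵐ r ∂A.runMeasure w, c ≤ limAvg (A.weights w r) := by
  obtain ⟨B, hB⟩ := A.exists_abs_weight_le
  filter_upwards [hgh.ae_tendsto_avg_sub hw, A.ae_mem_runs w] with r hr hrun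
  refine le_limAvg_of_eventually _ B c (fun i => hB _ _ _) fun ε hε => ?_
  filter_upwards [hr.eventually (lt_mem_nhds (neg_lt_zero.2 hε)), eventually_gt_atTop 0]
    with n hn hn0
  have hn' : (0 : ℝ) < n := by exact_mod_cast hn0
  have : c ≤ (1 / (n : ℝ)) * ∑ i ∈ Finset.range n, g (w i) (r i) := by
    rw [one_div_mul_eq_div, le_div_iff₀ hn']
    calc _ = ∑ i ∈ Finset.range n, c := by simp [mul_comm]
      _ ≤ _ := Finset.sum_le_sum fun i _ => hg _ _ (A.reachable_of_mem_runs w r hrun i)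
  linarith

/-- If the reachable states of gain `g s q` are closed under the letter `s`, then the value
`g s q` is taken with positive probability on some word that ends with `s` forever. -/
theorem IsGainBias.exists_limAvg_eq (hgh : A.IsGainBias g h) (s : S) (q : Q)
    (hq : A.Reachable q)
    (hcl : ∀ p, A.Reachable p → g s p = g s q → ∀ p', 0 < A.trans p s p' → g s p' = g s q) :
    ∃ (w : InfWord S) (k : ℕ), (∀ i, k ≤ i → w i = s) ∧ 0 < A.runMeasure w {r | r k = q} ∧
      ∀ᵐ r ∂A.runMeasure w, r k = q → limAvg (A.weights w r) = g s q := by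
  obtain ⟨u, k, hu⟩ := hq.exists_measure_pos
  -- A finite word that can lead to `q`, followed by `s` forever.
  set w : InfWord S := fun i => if i < k then u i else s with hw
  have hws : ∀ i, k ≤ i → w i = s := fun i hi => by simp [hw, hi]
  refine ⟨w, k, hws, hu w fun i hi => by simp [hw, hi], ?_⟩
  filter_upwards [hgh.ae_tendsto_avg_sub (slowlySwitching_of_eventually_const w k s hws),
    A.ae_mem_runs w] with r hr hrun hrk
  -- Closedness traps the run in the level set of `q` from time `k` on.
  have hconst : ∀ i, k ≤ i → g s (r i) = g s q := by
    intro i hi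
    induction i, hi using Nat.le_induction with
    | base => rw [hrk]
    | succ i hi ih =>
      refine hcl _ (A.reachable_of_mem_runs w r hrun i) ih _ ?_
      have := hrun.2 i
      rwa [hws i hi] at this
  have h1 : Tendsto (fun i => g (w i) (r i)) atTop (𝓝 (g s q)) :=
    tendsto_const_nhds.congr' (by
      filter_upwards [eventually_ge_atTop k] with i hi
      rw [hws i hi, hconst i hi])
  have h2 := hr.add h1.cesaro
  simp only [one_div, sub_add_cancel, zero_add] at h2
  simp only [limAvg, one_div]
  exact h2.liminf_eq

/-- Each reachable gain is at most a maximal one, which some ultimately constant word attains with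
positive probability, so all gains are at most `c`. -/
theorem posValue_le_of_slowlySwitching (A : ProbWeightedAutomaton Q S) (c : ℝ)
    (hc : ∀ (w : InfWord S) (k : ℕ) (s : S), (∀ i, k ≤ i → w i = s) → A.posValue limAvg w ≤ c)
    {w : InfWord S} (hw : SlowlySwitching w) : A.posValue limAvg w ≤ c := by
  obtain ⟨g, h, hgh⟩ := A.exists_isGainBias
  refine A.posValue_le w c (hgh.ae_limAvg_le hw c fun s q₀ hq₀ => ?_)
  obtain ⟨q, hq, hle, hcl⟩ := A.exists_closed_max s (g s) (hgh.harmonic s) q₀ hq₀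
  obtain ⟨w', k, hw', hpos, hae⟩ := hgh.exists_limAvg_eq s q hq hcl
  refine hle.trans ((A.le_posValue w' _ (hpos.trans_le (measure_mono_ae ?_))).trans
    (hc w' k s hw'))
  filter_upwards [hae, A.ae_mem_runs w'] with r h1 h2 h3
  exact ⟨h2, (h1 h3).ge⟩

/-- Dually, a minimal gain attained with positive probability bounds the almost-sure value of an
ultimately constant word from above, so no reachable gain is below `c`. -/
theorem le_asValue_of_slowlySwitching (A : ProbWeightedAutomaton Q S) (c : ℝ)
    (hc : ∀ (w : InfWord S) (k : ℕ) (s : S), (∀ i, k ≤ i → w i = s) → c ≤ A.asValue limAvg w)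
    {w : InfWord S} (hw : SlowlySwitching w) : c ≤ A.asValue limAvg w := by
  obtain ⟨g, h, hgh⟩ := A.exists_isGainBias
  refine A.le_asValue w c (hgh.ae_le_limAvg hw c fun s q₀ hq₀ => ?_)
  obtain ⟨q, hq, hle, hcl⟩ := A.exists_closed_min s (g s) (hgh.harmonic s) q₀ hq₀
  obtain ⟨w', k, hw', hpos, hae⟩ := hgh.exists_limAvg_eq s q hq hcl
  have hmeas : MeasurableSet {r : ℕ → Q | r k = q} :=
    measurableSet_eq_fun (measurable_pi_apply k) measurable_const
  refine (hc w' k s hw').trans ((A.asValue_le w' _ _ hmeas hpos ?_).trans hle)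
  filter_upwards [hae] with r h1 h2
  exact (h1 h2).le

end ProbWeightedAutomaton

/-! ### Letter frequencies are definable -/

/-- The deterministic one-state automaton that counts the letter `c`. -/
noncomputable def letterCounter (c : Letter) : ProbWeightedAutomaton Unit Letter where
  init := PMF.pure ()
  trans := fun _ _ => PMF.pure ()
  weight := fun _ s _ => if s = c then 1 else 0

theorem runs_letterCounter (c : Letter) (w : InfWord Letter) (r : ℕ → Unit) :
    r ∈ (letterCounter c).runs w := by
  refine ⟨?_, fun i => ?_⟩ <;> simp [letterCounter]

theorem limAvg_weights_letterCounter (c : Letter) (w : InfWord Letter) (r : ℕ → Unit) :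
    limAvg ((letterCounter c).weights w r) = letterFreq c w := rfl

theorem letterFreq_mem_posLimAvg (c : Letter) : letterFreq c ∈ PosLimAvg Letter := by
  refine ⟨Unit, inferInstance, ⊤, ⟨fun _ => trivial⟩, letterCounter c, funext fun w => ?_⟩
  have : {η : ℝ | 0 < (letterCounter c).runMeasure w {r | r ∈ (letterCounter c).runs w ∧
      η ≤ limAvg ((letterCounter c).weights w r)}} = Set.Iic (letterFreq c w) := by
    ext η
    by_cases h : η ≤ letterFreq c w <;>
      simp [runs_letterCounter, limAvg_weights_letterCounter, h]
  rw [ProbWeightedAutomaton.posValue, this, csSup_Iic]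

theorem letterFreq_mem_asLimAvg (c : Letter) : letterFreq c ∈ AsLimAvg Letter := by
  refine ⟨Unit, inferInstance, ⊤, ⟨fun _ => trivial⟩, letterCounter c, funext fun w => ?_⟩
  have : {η : ℝ | (letterCounter c).runMeasure w {r | r ∈ (letterCounter c).runs w ∧
      η ≤ limAvg ((letterCounter c).weights w r)} = 1} = Set.Iic (letterFreq c w) := by
    ext η
    by_cases h : η ≤ letterFreq c w <;>
      simp [runs_letterCounter, limAvg_weights_letterCounter, h]
  rw [ProbWeightedAutomaton.asValue, this, csSup_Iic]

/-! ### Frequencies on ultimately constant words and on the odd block word -/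

theorem letterFreq_of_eventually_const (c s : Letter) (w : InfWord Letter) (k : ℕ)
    (hw : ∀ i, k ≤ i → w i = s) : letterFreq c w = if s = c then 1 else 0 := by
  have h : Tendsto (fun i => (((if w i = c then 1 else 0 : ℚ)) : ℝ)) atTop
      (𝓝 (if s = c then 1 else 0)) :=
    tendsto_const_nhds.congr' (by
      filter_upwards [eventually_ge_atTop k] with i hi
      rw [hw i hi]
      split_ifs <;> simp)
  have h2 := h.cesaro
  simp only [letterFreq, limAvg, one_div]
  exact h2.liminf_eq

/-- The word whose blocks of equal letters have lengths `1, 3, 5, …`. -/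
def oddBlockWord : InfWord Letter := fun i => if Even i.sqrt then Letter.a else Letter.b

theorem slowlySwitching_oddBlockWord : SlowlySwitching oddBlockWord := by
  refine ⟨Nat.sqrt, fun _ _ => Nat.sqrt_le_sqrt, fun i hi => ?_, tendsto_sqrt_div_atTop⟩
  refine lt_of_le_of_ne (Nat.sqrt_le_sqrt (Nat.le_succ i)) fun h => hi ?_
  simp only [oddBlockWord, ← h]

/-- With `m = n.sqrt`, the complete blocks of lengths 1, 3, …, `2 * m - 1` contribute `-(-1) ^ m *
m`, and the current block contributes `n - m ^ 2` terms of sign `(-1) ^ m`. -/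
theorem sum_neg_one_pow_sqrt (n : ℕ) : ∑ i ∈ Finset.range n, (-1 : ℝ) ^ i.sqrt
    = (-1) ^ n.sqrt * (n - (n.sqrt : ℝ) ^ 2 - n.sqrt) := by
  induction n with
  | zero => simp
  | succ n ih =>
    rw [Finset.sum_range_succ, ih]
    rcases Nat.sqrt_succ_le_succ_sqrt n |>.eq_or_lt with h | h
    · have h1 : (n + 1).sqrt ^ 2 ≤ n + 1 := Nat.sqrt_le' _
      have h2 : n < (n.sqrt + 1) ^ 2 := Nat.lt_succ_sqrt' n
      have h' : (n + 1).sqrt = n.sqrt + 1 := h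
      rw [h'] at h1 ⊢
      have h3 : (n : ℝ) + 1 = (n.sqrt + 1 : ℝ) ^ 2 := by
        exact_mod_cast (show n + 1 = (n.sqrt + 1) ^ 2 by omega)
      have h4 : (n : ℝ) = (n.sqrt + 1 : ℝ) ^ 2 - 1 := by linarith
      push_cast
      rw [h4, pow_succ]
      ring
    · have h' : (n + 1).sqrt = n.sqrt :=
        le_antisymm (Nat.lt_succ_iff.1 h) (Nat.sqrt_le_sqrt (Nat.le_succ n))
      rw [h']
      push_cast
      ring

theorem tendsto_avg_neg_one_pow_sqrt :
    Tendsto (fun n : ℕ => (1 / (n : ℝ)) * ∑ i ∈ Finset.range n, (-1 : ℝ) ^ i.sqrt)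
      atTop (𝓝 0) := by
  refine squeeze_zero_norm (fun n => ?_) tendsto_sqrt_div_atTop
  have h1 : (n.sqrt : ℝ) ^ 2 ≤ n := by exact_mod_cast Nat.sqrt_le' n
  have h2 : (n : ℝ) ≤ (n.sqrt : ℝ) ^ 2 + 2 * n.sqrt := by
    have := Nat.sqrt_le_add n
    exact_mod_cast (show n ≤ n.sqrt ^ 2 + 2 * n.sqrt by nlinarith)
  rw [sum_neg_one_pow_sqrt, Real.norm_eq_abs, abs_mul, abs_mul, abs_pow, abs_neg, abs_one,
    one_pow, one_mul, abs_of_nonneg (by positivity : 0 ≤ 1 / (n : ℝ)), one_div_mul_eq_div]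
  gcongr
  rw [abs_le]
  constructor <;> linarith

theorem letterFreq_oddBlockWord (c : Letter) : letterFreq c oddBlockWord = 1 / 2 := by
  -- The indicator of either letter is 1/2 plus or minus half the sign of the block.
  obtain ⟨δ, hδ⟩ : ∃ δ : ℝ, ∀ i, (((if oddBlockWord i = c then 1 else 0 : ℚ)) : ℝ)
      = 1 / 2 + δ * (-1) ^ i.sqrt := by
    cases c
    · refine ⟨1 / 2, fun i => ?_⟩
      rcases Nat.even_or_odd i.sqrt with h | h
      · simp [oddBlockWord, h, h.neg_one_pow]; norm_num
      · simp [oddBlockWord, Nat.not_even_iff_odd.2 h, h.neg_one_pow]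
    · refine ⟨-(1 / 2), fun i => ?_⟩
      rcases Nat.even_or_odd i.sqrt with h | h
      · simp [oddBlockWord, h, h.neg_one_pow]
      · simp [oddBlockWord, Nat.not_even_iff_odd.2 h, h.neg_one_pow]; norm_num
  have h1 : Tendsto (fun n : ℕ => 1 / 2 +
      δ * ((1 / (n : ℝ)) * ∑ i ∈ Finset.range n, (-1 : ℝ) ^ i.sqrt)) atTop (𝓝 (1 / 2)) := by
    simpa only [mul_zero, add_zero] using
      (tendsto_avg_neg_one_pow_sqrt.const_mul δ).const_add (1 / 2)
  refine Tendsto.liminf_eq (h1.congr' ?_)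
  filter_upwards [eventually_gt_atTop 0] with n hn
  have hn' : (n : ℝ) ≠ 0 := by positivity
  simp only [hδ, Finset.sum_add_distrib, ← Finset.mul_sum, Finset.sum_const, Finset.card_range,
    nsmul_eq_mul]
  field_simp

instance : Finite Letter :=
  Finite.of_injective (fun c => decide (c = Letter.a)) fun c c' h => by
    cases c <;> cases c' <;> simp_all

/-! ### Non-definability and failure of closure -/

/-- A `PosLimAvg`-definable language that vanishes on the ultimately constant words is nonpositive
on every slowly switching word. -/
theorem le_zero_of_mem_posLimAvg {L : QuantLanguage Letter} (hL : L ∈ PosLimAvg Letter)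
    (h : ∀ (w : InfWord Letter) (k : ℕ) (s : Letter), (∀ i, k ≤ i → w i = s) → L w = 0)
    {w : InfWord Letter} (hw : SlowlySwitching w) : L w ≤ 0 := by
  obtain ⟨Q, _, _, _, A, rfl⟩ := hL
  have := Fintype.ofFinite Q
  exact A.posValue_le_of_slowlySwitching 0 (fun w k s hs => (h w k s hs).le) hw

/-- An `AsLimAvg`-definable language equal to `1` on the ultimately constant words is at least `1`
on every slowly switching word. -/
theorem one_le_of_mem_asLimAvg {L : QuantLanguage Letter} (hL : L ∈ AsLimAvg Letter)
    (h : ∀ (w : InfWord Letter) (k : ℕ) (s : Letter), (∀ i, k ≤ i → w i = s) → L w = 1)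
    {w : InfWord Letter} (hw : SlowlySwitching w) : 1 ≤ L w := by
  obtain ⟨Q, _, _, _, A, rfl⟩ := hL
  have := Fintype.ofFinite Q
  exact A.le_asValue_of_slowlySwitching 1 (fun w k s hs => (h w k s hs).ge) hw

theorem min_letterFreq_notMem_posLimAvg :
    (fun w => min (letterFreq Letter.a w) (letterFreq Letter.b w)) ∉ PosLimAvg Letter := by
  intro hL
  have := le_zero_of_mem_posLimAvg hL (fun w k s hs => by
    rw [letterFreq_of_eventually_const _ s w k hs, letterFreq_of_eventually_const _ s w k hs]
    cases s <;> simp) slowlySwitching_oddBlockWord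
  simp only [letterFreq_oddBlockWord, min_self] at this
  norm_num at this

theorem one_sub_max_letterFreq_notMem_posLimAvg :
    (fun w => 1 - max (letterFreq Letter.a w) (letterFreq Letter.b w)) ∉ PosLimAvg Letter := by
  intro hL
  have := le_zero_of_mem_posLimAvg hL (fun w k s hs => by
    rw [letterFreq_of_eventually_const _ s w k hs, letterFreq_of_eventually_const _ s w k hs]
    cases s <;> simp) slowlySwitching_oddBlockWord
  simp only [letterFreq_oddBlockWord, max_self] at this
  norm_num at this

theorem max_letterFreq_notMem_asLimAvg :
    (fun w => max (letterFreq Letter.a w) (letterFreq Letter.b w)) ∉ AsLimAvg Letter := by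
  intro hL
  have := one_le_of_mem_asLimAvg hL (fun w k s hs => by
    rw [letterFreq_of_eventually_const _ s w k hs, letterFreq_of_eventually_const _ s w k hs]
    cases s <;> simp) slowlySwitching_oddBlockWord
  simp only [letterFreq_oddBlockWord, max_self] at this
  norm_num at this

theorem mainTheorem7 :
    (letterFreq Letter.a ∈ PosLimAvg Letter ∧ letterFreq Letter.b ∈ PosLimAvg Letter ∧
      (fun w => min (letterFreq Letter.a w) (letterFreq Letter.b w)) ∉ PosLimAvg Letter ∧
      (fun w => 1 - max (letterFreq Letter.a w) (letterFreq Letter.b w)) ∉ PosLimAvg Letter) ∧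
    (letterFreq Letter.a ∈ AsLimAvg Letter ∧ letterFreq Letter.b ∈ AsLimAvg Letter ∧
      (fun w => max (letterFreq Letter.a w) (letterFreq Letter.b w)) ∉ AsLimAvg Letter) ∧
    ¬ ClosedUnderMin PosLimAvg ∧ ¬ ClosedUnderMax AsLimAvg :=
  ⟨⟨letterFreq_mem_posLimAvg _, letterFreq_mem_posLimAvg _, min_letterFreq_notMem_posLimAvg,
    one_sub_max_letterFreq_notMem_posLimAvg⟩,
    ⟨letterFreq_mem_asLimAvg _, letterFreq_mem_asLimAvg _, max_letterFreq_notMem_asLimAvg⟩,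
    fun h => min_letterFreq_notMem_posLimAvg
      (h Letter _ _ (letterFreq_mem_posLimAvg _) (letterFreq_mem_posLimAvg _)),
    fun h => max_letterFreq_notMem_asLimAvg
      (h Letter _ _ (letterFreq_mem_asLimAvg _) (letterFreq_mem_asLimAvg _))⟩
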